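/- For a locally compact group $G$ with a fixed left Haar measure, $s\in G$ and $f\in L^1(G)$, write $(\delta_s*f*\delta_{s^{-1}})(x)=\Delta(s)\,f(s^{-1}xs)$, where $\Delta$ is the modular function of $G$ (with $\int f(xs)\,dx=\Delta(s)^{-1}\int f(x)\,dx$), so that $f\mapsto\delta_s*f*\delta_{s^{-1}}$ is an isometry of $L^1(G)$. The group $G$ is called QSIN (quasi-small invariant neighbourhood) if $L^1(G)$ admits a bounded approximate identity which is asymptotically inner invariant, that is, a net $(e_\alpha)$ in $L^1(G)$ with $\sup_\alpha\|e_\alpha\|_1<\infty$ such that $\|e_\alpha*f-f\|_1\to0$ and $\|f*e_\alpha-f\|_1\to0$ for every $f\in L^1(G)$, and $\|\delta_s*e_\alpha*\delta_{s^{-1}}-e_\alpha\|_1\to0$ for every $s\in G$. Let $\Gamma$ be a dense subgroup of $\mathrm{SL}_2(\mathbb{R})$, regarded as a discrete group, and let $G=\mathbb{R}^2\rtimes\Gamma$ be the semidirect product for the natural linear action of $\Gamma$ on $\mathbb{R}^2$, with the product of the usual topology of $\mathbb{R}^2$ and the discrete topology of $\Gamma$. Then the locally compact group $G$ is not QSIN.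 -/

import Mathlib

open MeasureTheory Filter Topology
open scoped NNReal ENNReal MatrixGroups

/-! ## Quasi-small invariant neighbourhood groups -/

section QSIN

universe u

variable {G : Type u} [Group G] [TopologicalSpace G] [IsTopologicalGroup G]
  [LocallyCompactSpace G] [MeasurableSpace G] [BorelSpace G]

/-- The `L¹`-norm (with values in `[0, ∞]`) with respect to left Haar measure. -/
noncomputable def haarL1Norm (f : G → ℂ) : ℝ≥0∞ :=
  eLpNorm f 1 (Measure.haar : Measure G)

/-- Convolution in `L¹(G)`: `(f * g)(x) = ∫ f(y) g(y⁻¹ x) dy` for left Haar measure `dy`. -/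
noncomputable def haarConv (f g : G → ℂ) (x : G) : ℂ :=
  ∫ y, f y * g (y⁻¹ * x) ∂(Measure.haar : Measure G)

/-- The inner action of `s` on `L¹(G)`, that is, `f ↦ δ_s * f * δ_{s⁻¹}`. Mathlib's modular
character `m` satisfies `∫ f(x s) dx = m(s) ∫ f(x) dx`, so that the factor `m(s)⁻¹` makes this
action isometric on `L¹(G)`. -/
noncomputable def innerTranslate (s : G) (f : G → ℂ) (x : G) : ℂ :=
  (((Measure.modularCharacter s)⁻¹ : ℝ≥0) : ℂ) * f (s⁻¹ * x * s)

/-- The net `e` in `L¹(G)` is a bounded (two-sided) approximate identity. -/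
structure IsBoundedApproxIdentity {ι : Type*} [Preorder ι] (e : ι → G → ℂ) : Prop where
  integrable : ∀ i, Integrable (e i) (Measure.haar : Measure G)
  bounded : ∃ C : ℝ≥0, ∀ i, haarL1Norm (e i) ≤ C
  left_approx : ∀ f : G → ℂ, Integrable f (Measure.haar : Measure G) →
    Tendsto (fun i => haarL1Norm (haarConv (e i) f - f)) atTop (𝓝 0)
  right_approx : ∀ f : G → ℂ, Integrable f (Measure.haar : Measure G) →
    Tendsto (fun i => haarL1Norm (haarConv f (e i) - f)) atTop (𝓝 0)

/-- The net `e` is asymptotically inner invariant: `‖δ_s * e_i * δ_{s⁻¹} - e_i‖₁ → 0` for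
each `s` in `G`. -/
def IsAsymptoticallyInnerInvariant {ι : Type*} [Preorder ι] (e : ι → G → ℂ) : Prop :=
  ∀ s : G, Tendsto (fun i => haarL1Norm (innerTranslate s (e i) - e i)) atTop (𝓝 0)

variable (G) in
/-- A locally compact group `G` is QSIN (quasi-small invariant neighbourhood) if `L¹(G)` admits a
bounded approximate identity which is asymptotically inner invariant. -/
def IsQSIN : Prop :=
  ∃ (ι : Type u) (_ : Preorder ι) (_ : IsDirectedOrder ι) (_ : Nonempty ι) (e : ι → G → ℂ),
    IsBoundedApproxIdentity e ∧ IsAsymptoticallyInnerInvariant e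

end QSIN

/-! ## The group `ℝ² ⋊ Γ` with `Γ` discrete -/

/-- The natural linear action of a subgroup `Γ` of `SL₂(ℝ)` on `ℝ²` by automorphisms. -/
noncomputable def planeAction (Γ : Subgroup SL(2, ℝ)) :
    Γ →* MulAut (Multiplicative (Fin 2 → ℝ)) where
  toFun γ := AddEquiv.toMultiplicative
    (Matrix.SpecialLinearGroup.toLin' (γ : SL(2, ℝ))).toAddEquiv
  map_one' := by ext x; simp
  map_mul' a b := by ext x; simp

/-- The semidirect product `ℝ² ⋊ Γ`, with `(v, γ)(w, δ) = (v + γ w, γ δ)`. -/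
abbrev PlaneSemidirect (Γ : Subgroup SL(2, ℝ)) : Type :=
  Multiplicative (Fin 2 → ℝ) ⋊[planeAction Γ] Γ

namespace PlaneSemidirect

variable (Γ : Subgroup SL(2, ℝ))

/-- The product topology of the usual topology on `ℝ²` and the discrete topology on `Γ`. -/
noncomputable instance instTopologicalSpace : TopologicalSpace (PlaneSemidirect Γ) :=
  TopologicalSpace.induced SemidirectProduct.equivProd
    (@instTopologicalSpaceProd (Multiplicative (Fin 2 → ℝ)) Γ inferInstance ⊥)

theorem continuous_left : Continuous (fun x : PlaneSemidirect Γ => x.left) :=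
  letI : TopologicalSpace Γ := ⊥
  continuous_fst.comp (continuous_induced_dom (f := SemidirectProduct.equivProd))

theorem continuous_right :
    @Continuous (PlaneSemidirect Γ) Γ _ ⊥ (fun x : PlaneSemidirect Γ => x.right) :=
  letI : TopologicalSpace Γ := ⊥
  continuous_snd.comp (continuous_induced_dom (f := SemidirectProduct.equivProd))

theorem continuous_planeAction (γ : Γ) : Continuous (planeAction Γ γ) :=
  (Matrix.toLin' (γ : SL(2, ℝ)).1).continuous_of_finiteDimensional

/-- The action is jointly continuous along any map that is continuous to the discrete `Γ`. -/
theorem continuous_act {X : Type*} [TopologicalSpace X] {g : X → Γ}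
    {v : X → Multiplicative (Fin 2 → ℝ)} (hg : @Continuous X Γ _ ⊥ g) (hv : Continuous v) :
    Continuous (fun x => planeAction Γ (g x) (v x)) := by
  let _ : TopologicalSpace Γ := ⊥
  have : DiscreteTopology Γ := ⟨rfl⟩
  rw [continuous_iff_continuousAt]
  intro x
  have hopen : ∀ᶠ y in 𝓝 x, g y = g x :=
    ((isOpen_discrete {g x}).preimage hg).mem_nhds rfl
  refine (((continuous_planeAction Γ (g x)).comp hv).continuousAt).congr ?_
  filter_upwards [hopen] with y hy
  simp [hy]

instance instIsTopologicalGroup : IsTopologicalGroup (PlaneSemidirect Γ) := by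
  let _ : TopologicalSpace Γ := ⊥
  have : DiscreteTopology Γ := ⟨rfl⟩
  have hl := continuous_left Γ
  have hr : Continuous (fun x : PlaneSemidirect Γ => x.right) := continuous_right Γ
  have hr1 : Continuous (fun p : PlaneSemidirect Γ × PlaneSemidirect Γ => p.1.right) :=
    hr.comp continuous_fst
  have hr2 : Continuous (fun p : PlaneSemidirect Γ × PlaneSemidirect Γ => p.2.right) :=
    hr.comp continuous_snd
  have hri : Continuous (fun x : PlaneSemidirect Γ => x.right⁻¹) :=
    (continuous_of_discreteTopology (f := fun γ : Γ => γ⁻¹)).comp hr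
  exact
    { continuous_mul := continuous_induced_rng.2 (Continuous.prodMk
        ((hl.comp continuous_fst).mul (continuous_act Γ hr1 (hl.comp continuous_snd)))
        ((continuous_of_discreteTopology (f := fun q : Γ × Γ => q.1 * q.2)).comp
          (hr1.prodMk hr2)))
      continuous_inv := continuous_induced_rng.2 (Continuous.prodMk
        (continuous_act Γ hri hl.inv) hri) }

instance instLocallyCompactSpace : LocallyCompactSpace (PlaneSemidirect Γ) := by
  let _ : TopologicalSpace Γ := ⊥
  have : DiscreteTopology Γ := ⟨rfl⟩
  exact (SemidirectProduct.equivProd.toHomeomorphOfIsInducing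
    ⟨rfl⟩ : PlaneSemidirect Γ ≃ₜ _).isClosedEmbedding.locallyCompactSpace

instance instT2Space : T2Space (PlaneSemidirect Γ) := by
  let _ : TopologicalSpace Γ := ⊥
  have : DiscreteTopology Γ := ⟨rfl⟩
  exact (SemidirectProduct.equivProd.toHomeomorphOfIsInducing
    ⟨rfl⟩ : PlaneSemidirect Γ ≃ₜ _).isEmbedding.t2Space

noncomputable instance instMeasurableSpace : MeasurableSpace (PlaneSemidirect Γ) := borel _

instance instBorelSpace : BorelSpace (PlaneSemidirect Γ) := ⟨rfl⟩

end PlaneSemidirect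

/-! Write `N` for the open normal subgroup `ℝ²`, on which `Γ` acts by conjugation through its linear
action. If `δ_s * f * δ_{s⁻¹}` is close to `f`, then `|f|` has nearly the same mass on a set and on
its conjugate by `s` (`setLIntegral_enorm_le_conj_add`). The masses of `|e_i|` on `N` are thus
asymptotically `Γ`-invariant. No such mass survives on `ℝ² \ {0}`. Two `Γ`-translates of a suitable
double cone cover this set, so the cone carries at least about half of the mass on `N`. Three
translates are disjoint, so it carries at most about a third. The cone conditions leave room for
perturbation, so density of `Γ` supplies the required elements (`exists_setLIntegral_ker_le`). The
origin is Haar-null, hence the mass of `e_i` on `N` tends to `0`. An approximate identity forbids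
this: on a subset of `N`, convolving `e_i` with the indicator of that subset sees only `e_i`
restricted to `N` (`haar_le_mul_add_haarL1Norm`). -/

section ConjugationInvariance

universe u

variable {G : Type u} [Group G] [TopologicalSpace G] [IsTopologicalGroup G]
  [LocallyCompactSpace G] [MeasurableSpace G] [BorelSpace G]

theorem map_mul_right_haar_eq_modularCharacter_smul (s : G) :
    Measure.map (· * s) (Measure.haar : Measure G) =
      Measure.modularCharacter s • (Measure.haar : Measure G) := by
  have hreg : Measure.Regular (Measure.map (· * s) (Measure.haar : Measure G)) :=
    Measure.Regular.map (Homeomorph.mulRight s)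
  have h := Measure.isMulLeftInvariant_eq_smul_of_regular
    (Measure.map (· * s) (Measure.haar : Measure G)) Measure.haar
  rw [h, ← Measure.modularCharacterFun_eq_haarScalarFactor]
  rfl

/-- Left translation preserves Haar measure, so only the right translation by `s` contributes a
factor. Translations are measurable equivalences, so `F` may be arbitrary. -/
theorem lintegral_conj_haar (s : G) (F : G → ℝ≥0∞) :
    ∫⁻ x, F (s⁻¹ * x * s) ∂(Measure.haar : Measure G) =
      Measure.modularCharacter s * ∫⁻ x, F x ∂(Measure.haar : Measure G) := by
  have h1 := lintegral_mul_left_eq_self (μ := (Measure.haar : Measure G)) (fun x => F (x * s)) s⁻¹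
  have h2 := lintegral_map_equiv (μ := (Measure.haar : Measure G)) F (MeasurableEquiv.mulRight s)
  have h3 := map_mul_right_haar_eq_modularCharacter_smul s
  simp only [MeasurableEquiv.coe_mulRight] at h2
  rw [h3, lintegral_smul_measure] at h2
  rw [h1, ← h2]
  rfl

/-- The mass of an `L¹`-function on a set is almost at most its mass on a conjugate of the set. -/
theorem setLIntegral_enorm_le_conj_add (s : G) {f : G → ℂ}
    (hf : Integrable f (Measure.haar : Measure G)) {A : Set G} (hA : MeasurableSet A) :
    ∫⁻ x in A, ‖f x‖ₑ ∂(Measure.haar : Measure G) ≤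
      ∫⁻ x in {x | s⁻¹ * x * s ∈ A}, ‖f x‖ₑ ∂(Measure.haar : Measure G) +
        haarL1Norm (innerTranslate s f - f) := by
  have hB : MeasurableSet {x | s⁻¹ * x * s ∈ A} :=
    hA.preimage ((measurable_const_mul s⁻¹).mul_const s)
  have hm0 : Measure.modularCharacter s ≠ 0 := (Measure.modularCharacterFun_pos s).ne'
  -- Change of variables: the normalising factor `m(s)⁻¹` cancels the scaling of Haar measure under
  -- conjugation.
  have key : ∫⁻ x in {x | s⁻¹ * x * s ∈ A}, ‖innerTranslate s f x‖ₑ ∂(Measure.haar : Measure G) =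
      ∫⁻ x in A, ‖f x‖ₑ ∂(Measure.haar : Measure G) := by
    rw [← lintegral_indicator hB, ← lintegral_indicator hA]
    have h := lintegral_conj_haar s
      (fun x => (((Measure.modularCharacter s)⁻¹ : ℝ≥0) : ℝ≥0∞) * A.indicator (fun x => ‖f x‖ₑ) x)
    rw [lintegral_const_mul' _ (fun x => A.indicator (fun x => ‖f x‖ₑ) x) ENNReal.coe_ne_top,
      ← mul_assoc, ← ENNReal.coe_mul,
      mul_inv_cancel₀ hm0, ENNReal.coe_one, one_mul] at h
    rw [← h]
    refine lintegral_congr fun x => ?_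
    by_cases hx : s⁻¹ * x * s ∈ A
    · have hx' : x ∈ {x | s⁻¹ * x * s ∈ A} := hx
      rw [Set.indicator_of_mem hx, Set.indicator_of_mem hx', innerTranslate, enorm_mul]
      congr 1
      rw [← ofReal_norm, Complex.norm_real, NNReal.norm_eq, ENNReal.ofReal_coe_nnreal]
    · have hx' : x ∉ {x | s⁻¹ * x * s ∈ A} := hx
      rw [Set.indicator_of_notMem hx, Set.indicator_of_notMem hx', mul_zero]
  rw [← key, haarL1Norm, eLpNorm_one_eq_lintegral_enorm]
  calc _ ≤ ∫⁻ x in {x | s⁻¹ * x * s ∈ A},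
        (‖f x‖ₑ + ‖(innerTranslate s f - f) x‖ₑ) ∂(Measure.haar : Measure G) := by
        refine lintegral_mono fun x => ?_
        have h := enorm_add_le (f x) ((innerTranslate s f - f) x)
        simpa using h
    _ = _ := lintegral_add_left' hf.aestronglyMeasurable.enorm.restrict _
    _ ≤ _ := by gcongr; exact Measure.restrict_le_self

/-- For `K` inside a subgroup `N`, an `L¹`-function with small mass on `N` cannot act almost
like the identity on the indicator of `K`. -/
theorem haar_le_mul_add_haarL1Norm (e : G → ℂ) (N : Subgroup G) (hN : MeasurableSet (N : Set G))
    {K : Set G} (hK : MeasurableSet K) (hKN : K ⊆ N) :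
    (Measure.haar : Measure G) K ≤
      (∫⁻ x in (N : Set G), ‖e x‖ₑ ∂(Measure.haar : Measure G)) * (Measure.haar : Measure G) K +
        haarL1Norm (haarConv e (K.indicator 1) - K.indicator 1) := by
  set M := ∫⁻ x in (N : Set G), ‖e x‖ₑ ∂(Measure.haar : Measure G) with hM
  -- For `x ∈ K`, only those `y` with `y⁻¹ * x ∈ K` contribute, and these lie in `N`.
  have hconv : ∀ x ∈ K, ‖haarConv e (K.indicator 1) x‖ₑ ≤ M := by
    intro x hx
    refine (enorm_integral_le_lintegral_enorm _).trans ?_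
    rw [hM, ← lintegral_indicator hN]
    refine lintegral_mono fun y => ?_
    by_cases hy : y⁻¹ * x ∈ K
    · have hyN : y ∈ (N : Set G) := by
        have h := N.mul_mem (hKN hx) (N.inv_mem (hKN hy))
        simpa using h
      simp [Set.indicator_of_mem hy, Set.indicator_of_mem hyN]
    · simp [Set.indicator_of_notMem hy]
  generalize haarConv e (K.indicator 1) = c at hconv ⊢
  rw [haarL1Norm, eLpNorm_one_eq_lintegral_enorm]
  calc (Measure.haar : Measure G) K = ∫⁻ _ in K, 1 ∂(Measure.haar : Measure G) := by simp
    _ ≤ ∫⁻ x in K, (M + ‖(c - K.indicator (1 : G → ℂ)) x‖ₑ) ∂(Measure.haar : Measure G) := by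
        refine setLIntegral_mono' hK fun x hx => ?_
        have h := enorm_sub_le (E := ℂ) (a := c x) (b := (c - K.indicator (1 : G → ℂ)) x)
        simp only [Pi.sub_apply, sub_sub_cancel, Set.indicator_of_mem hx, Pi.one_apply,
          enorm_one] at h ⊢
        exact h.trans (by gcongr; exact hconv x hx)
    _ = M * (Measure.haar : Measure G) K +
          ∫⁻ x in K, ‖(c - K.indicator (1 : G → ℂ)) x‖ₑ ∂(Measure.haar : Measure G) := by
        rw [lintegral_add_left measurable_const, setLIntegral_const]
    _ ≤ _ := by gcongr; exact Measure.restrict_le_self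

end ConjugationInvariance

/-! ### Approximating matrices by elements of `Γ` -/

section DenseSubgroups

/-- A dense subgroup of `SL(2, ℝ)` has elements with entries near any prescribed ones. -/
theorem exists_mem_entries_near {Γ : Subgroup SL(2, ℝ)} (hΓ : Dense (Γ : Set SL(2, ℝ)))
    (k : SL(2, ℝ)) {ε : ℝ} (hε : 0 < ε) : ∃ γ : Γ, ∀ i j, |(γ : SL(2, ℝ)) i j - k i j| < ε := by
  have hopen : IsOpen {g : SL(2, ℝ) | ∀ i j, |g i j - k i j| < ε} := by
    simp only [Set.ofPred_forall]
    refine isOpen_iInter_of_finite fun i => isOpen_iInter_of_finite fun j => ?_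
    have hc : Continuous fun g : SL(2, ℝ) => g i j :=
      (continuous_apply_apply i j).comp continuous_subtype_val
    exact isOpen_lt (hc.sub continuous_const).abs continuous_const
  obtain ⟨g, hg, hgΓ⟩ := hΓ.inter_open_nonempty _ hopen ⟨k, by simp [hε]⟩
  exact ⟨⟨g, hgΓ⟩, hg⟩

end DenseSubgroups

/-! ### Covering and disjointness of perturbed cones -/

section Cones

/-- A closed double cone around the horizontal axis, without its vertex. -/
def horizontalCone : Set (Fin 2 → ℝ) := {v | |v 1| ≤ 2 * |v 0| ∧ v 0 ≠ 0}

theorem measurableSet_horizontalCone : MeasurableSet horizontalCone := by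
  refine (IsClosed.measurableSet ?_).inter (IsOpen.measurableSet ?_)
  · exact isClosed_le (continuous_apply 1).abs (continuous_const.mul (continuous_apply 0).abs)
  · exact isOpen_ne_fun (continuous_apply 0) continuous_const

theorem abs_mul_le_of_abs_sub_lt {a b ε : ℝ} (h : |a - b| < ε) (x : ℝ) :
    |a * x - b * x| ≤ ε * |x| := by
  rw [← sub_mul, abs_mul]
  gcongr

theorem mulVec_mem_horizontalCone_iff {k : Matrix (Fin 2) (Fin 2) ℝ} {v : Fin 2 → ℝ} :
    k.mulVec v ∈ horizontalCone ↔ |k 1 0 * v 0 + k 1 1 * v 1| ≤ 2 * |k 0 0 * v 0 + k 0 1 * v 1| ∧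
      k 0 0 * v 0 + k 0 1 * v 1 ≠ 0 := by
  simp [horizontalCone]

/-- The quarter turn pulls the cone back to `|v 0| ≤ 2 * |v 1|`. The two cones overlap because `2 >
1`, which absorbs the error `1 / 100`. -/
theorem mem_horizontalCone_or_mulVec_mem {k : Matrix (Fin 2) (Fin 2) ℝ}
    (hk : ∀ i j, |k i j - !![0, 1; -1, 0] i j| < 1 / 100) {v : Fin 2 → ℝ} (hv : v ≠ 0) :
    v ∈ horizontalCone ∨ k.mulVec v ∈ horizontalCone := by
  have h00 := abs_le.1 (abs_mul_le_of_abs_sub_lt (hk 0 0) (v 0))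
  have h01 := abs_le.1 (abs_mul_le_of_abs_sub_lt (hk 0 1) (v 1))
  have h10 := abs_le.1 (abs_mul_le_of_abs_sub_lt (hk 1 0) (v 0))
  have h11 := abs_le.1 (abs_mul_le_of_abs_sub_lt (hk 1 1) (v 1))
  rw [mulVec_mem_horizontalCone_iff]
  simp only [horizontalCone, Set.mem_ofPred_eq, Matrix.of_apply, Matrix.cons_val', Matrix.cons_val_zero,
    Matrix.cons_val_one, Matrix.cons_val_fin_one] at h00 h01 h10 h11 ⊢
  by_cases hA : |v 1| ≤ 2 * |v 0|
  · refine Or.inl ⟨hA, fun h0 => hv ?_⟩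
    have h1 : v 1 = 0 := by simpa [h0] using hA
    ext i
    fin_cases i <;> simp [h0, h1]
  · right
    push Not at hA
    have hpos := abs_nonneg (v 0)
    have hlow : 9 / 10 * |v 1| ≤ |k 0 0 * v 0 + k 0 1 * v 1| := by
      rcases abs_cases (v 1) with ⟨h, -⟩ | ⟨h, -⟩
      · exact le_trans (by linarith) (le_abs_self _)
      · exact le_trans (by linarith) (neg_le_abs _)
    refine ⟨?_, fun h0 => ?_⟩
    · refine le_trans (abs_le.2 ?_) (mul_le_mul_of_nonneg_left hlow two_pos.le)
      constructor <;> linarith [neg_abs_le (v 0), le_abs_self (v 0)]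
    · rw [h0, abs_zero] at hlow
      linarith

/-- The exact matrix pulls the cone back to the thin cone `|v 0 - a * v 1| ≤ |v 1| / 50` about the
line `v 0 = a * v 1`. The constants are twice the bound `hup` on the first coordinate plus the error
`1 / 100` of the second row. -/
theorem abs_sub_mul_le_of_mulVec_mem_horizontalCone {k : Matrix (Fin 2) (Fin 2) ℝ} {a : ℝ}
    (hk : ∀ i j, |k i j - !![0, 1 / 10; -10, 10 * a] i j| < 1 / 100) {v : Fin 2 → ℝ}
    (hv : k.mulVec v ∈ horizontalCone) :
    |10 * v 0 - 10 * a * v 1| ≤ 3 / 100 * |v 0| + 23 / 100 * |v 1| ∧ v ≠ 0 := by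
  have h00 := abs_le.1 (abs_mul_le_of_abs_sub_lt (hk 0 0) (v 0))
  have h01 := abs_le.1 (abs_mul_le_of_abs_sub_lt (hk 0 1) (v 1))
  have h10 := abs_le.1 (abs_mul_le_of_abs_sub_lt (hk 1 0) (v 0))
  have h11 := abs_le.1 (abs_mul_le_of_abs_sub_lt (hk 1 1) (v 1))
  rw [mulVec_mem_horizontalCone_iff] at hv
  simp only [Matrix.of_apply, Matrix.cons_val', Matrix.cons_val_zero,
    Matrix.cons_val_one, Matrix.cons_val_fin_one] at h00 h01 h10 h11
  refine ⟨?_, fun h0 => hv.2 (by simp [h0])⟩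
  have hup : |k 0 0 * v 0 + k 0 1 * v 1| ≤ 1 / 100 * |v 0| + 11 / 100 * |v 1| := by
    rw [abs_le]
    constructor <;> linarith [neg_abs_le (v 1), le_abs_self (v 1)]
  have h := abs_le.1 (hv.1.trans (mul_le_mul_of_nonneg_left hup two_pos.le))
  rw [abs_le]
  constructor <;> linarith

theorem abs_pair_pos {v : Fin 2 → ℝ} (hv : v ≠ 0) : 0 < |v 0| + |v 1| := by
  by_contra! h
  refine hv ?_
  have h0 : v 0 = 0 := abs_nonpos_iff.1 (by linarith [abs_nonneg (v 1)])
  have h1 : v 1 = 0 := abs_nonpos_iff.1 (by linarith [abs_nonneg (v 0)])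
  ext i
  fin_cases i <;> simp [h0, h1]

/-- The axis `v 0 = a * v 1` with `a ≤ 1 / 4` stays well away from the horizontal cone, where `|v 0|
≥ |v 1| / 2`. -/
theorem notMem_horizontalCone_of_mulVec_mem {k : Matrix (Fin 2) (Fin 2) ℝ} {a : ℝ}
    (ha0 : 0 ≤ a) (ha : a ≤ 1 / 4)
    (hk : ∀ i j, |k i j - !![0, 1 / 10; -10, 10 * a] i j| < 1 / 100) {v : Fin 2 → ℝ}
    (hv : k.mulVec v ∈ horizontalCone) : v ∉ horizontalCone := by
  obtain ⟨h, h0⟩ := abs_sub_mul_le_of_mulVec_mem_horizontalCone hk hv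
  rintro ⟨hA, -⟩
  have hpos := abs_pair_pos h0
  have h1 : |10 * v 0| - |10 * a * v 1| ≤ |10 * v 0 - 10 * a * v 1| := abs_sub_abs_le_abs_sub _ _
  rw [abs_mul, abs_mul, abs_of_pos (show (0 : ℝ) < 10 by norm_num),
    abs_of_nonneg (show 0 ≤ 10 * a by linarith)] at h1
  have h2 : 10 * a * |v 1| ≤ 10 / 4 * |v 1| := by gcongr; linarith
  linarith

/-- The thin cones about `v 0 = 0` and `v 0 = v 1 / 4` are too narrow to meet. -/
theorem mulVec_notMem_horizontalCone_of_mulVec_mem {k l : Matrix (Fin 2) (Fin 2) ℝ}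
    (hk : ∀ i j, |k i j - !![0, 1 / 10; -10, 10 * 0] i j| < 1 / 100)
    (hl : ∀ i j, |l i j - !![0, 1 / 10; -10, 10 * (1 / 4)] i j| < 1 / 100) {v : Fin 2 → ℝ}
    (hv : k.mulVec v ∈ horizontalCone) : l.mulVec v ∉ horizontalCone := by
  intro hv'
  obtain ⟨h, h0⟩ := abs_sub_mul_le_of_mulVec_mem_horizontalCone hk hv
  obtain ⟨h', -⟩ := abs_sub_mul_le_of_mulVec_mem_horizontalCone hl hv'
  have hpos := abs_pair_pos h0
  rw [abs_le] at h h'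
  rcases abs_cases (v 0) with ⟨h2, -⟩ | ⟨h2, -⟩ <;>
    rcases abs_cases (v 1) with ⟨h3, -⟩ | ⟨h3, -⟩ <;> rw [h2, h3] at h h' hpos <;> linarith

end Cones

/-! ### Mass on the normal subgroup `ℝ²` -/

namespace PlaneSemidirect

variable (Γ : Subgroup SL(2, ℝ))

/-- The copy of a subset of the plane in `ℝ² ⋊ Γ`. -/
def planeSet (P : Set (Fin 2 → ℝ)) : Set (PlaneSemidirect Γ) :=
  {p | p.right = 1 ∧ Multiplicative.toAdd p.left ∈ P}

theorem isOpen_ker_rightHom :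
    IsOpen ((SemidirectProduct.rightHom : PlaneSemidirect Γ →* Γ).ker : Set (PlaneSemidirect Γ)) := by
  let _ : TopologicalSpace Γ := ⊥
  have : DiscreteTopology Γ := ⟨rfl⟩
  exact (isOpen_discrete {(1 : Γ)}).preimage (continuous_right Γ)

variable {Γ}

theorem measurableSet_planeSet {P : Set (Fin 2 → ℝ)} (hP : MeasurableSet P) :
    MeasurableSet (planeSet Γ P) := by
  have hl : Continuous fun p : PlaneSemidirect Γ => Multiplicative.toAdd p.left :=
    continuous_left Γ
  exact (isOpen_ker_rightHom Γ).measurableSet.inter (hl.measurable hP)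

theorem toAdd_planeAction (γ : Γ) (v : Multiplicative (Fin 2 → ℝ)) :
    Multiplicative.toAdd (planeAction Γ γ v) =
      (γ : SL(2, ℝ)).1.mulVec (Multiplicative.toAdd v) := rfl

theorem conj_mem_planeSet (γ : Γ) (P : Set (Fin 2 → ℝ)) :
    {p : PlaneSemidirect Γ | (SemidirectProduct.inr γ)⁻¹ * p * SemidirectProduct.inr γ ∈
      planeSet Γ P} = planeSet Γ {v | ((γ⁻¹ : Γ) : SL(2, ℝ)).1.mulVec v ∈ P} := by
  ext p
  have hr : ((SemidirectProduct.inr γ)⁻¹ * p * SemidirectProduct.inr γ :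
      PlaneSemidirect Γ).right = γ⁻¹ * p.right * γ := by simp
  have hl : ((SemidirectProduct.inr γ)⁻¹ * p * SemidirectProduct.inr γ :
      PlaneSemidirect Γ).left = planeAction Γ γ⁻¹ p.left := by simp
  have hone : γ⁻¹ * p.right * γ = 1 ↔ p.right = 1 := by
    rw [mul_eq_one_iff_eq_inv, mul_eq_left]
  simp only [planeSet, Set.mem_ofPred_eq, hr, hl, hone, toAdd_planeAction]

/-- Non-discreteness makes Haar measure atomless, so the vertex of the cones can be ignored. -/
instance neBot_punctured_nhds_one : (𝓝[≠] (1 : PlaneSemidirect Γ)).NeBot := by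
  let _ : TopologicalSpace Γ := ⊥
  let j : (Fin 2 → ℝ) → PlaneSemidirect Γ := fun v => SemidirectProduct.inl (Multiplicative.ofAdd v)
  have hj : Continuous j :=
    continuous_induced_rng.2 (continuous_ofAdd.prodMk continuous_const)
  have ht : Tendsto j (𝓝[≠] 0) (𝓝[≠] 1) := by
    refine tendsto_nhdsWithin_of_tendsto_nhds_of_eventually_within _
      ((hj.tendsto 0).mono_left nhdsWithin_le_nhds) ?_
    filter_upwards [self_mem_nhdsWithin] with v hv h
    exact hv (congrArg (fun p : PlaneSemidirect Γ => Multiplicative.toAdd p.left) h)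
  exact ht.neBot

/-- Up to errors, `M ≤ 2 * a` and `3 * a ≤ M`, so `3 * M ≤ 6 * a ≤ 2 * M`; finiteness of `M` allows
cancelling `2 * M`. -/
theorem le_three_mul_add_two_mul {M a b c d r s t : ℝ≥0∞} (hM : M ≠ ⊤) (hup : M ≤ a + d)
    (hlow : a + b + c ≤ M) (hr : d ≤ a + r) (hs : a ≤ b + s) (ht : a ≤ c + t) :
    M ≤ 3 * r + 2 * (s + t) := by
  have h1 : M ≤ 2 * a + r := by
    refine hup.trans ?_
    rw [two_mul, add_assoc]
    gcongr
  have h2 : 3 * a ≤ M + (s + t) := by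
    calc 3 * a = a + a + a := by ring
      _ ≤ a + (b + s) + (c + t) := by gcongr
      _ = a + b + c + (s + t) := by ring
      _ ≤ M + (s + t) := by gcongr
  refine (ENNReal.add_le_add_iff_left (a := 2 * M) (ENNReal.mul_ne_top (by simp) hM)).1 ?_
  calc 2 * M + M = 3 * M := by ring
    _ ≤ 3 * (2 * a + r) := by gcongr
    _ = 2 * (3 * a) + 3 * r := by ring
    _ ≤ 2 * (M + (s + t)) + 3 * r := by gcongr
    _ = 2 * M + (3 * r + 2 * (s + t)) := by ring

/-- An integrable function on `ℝ² ⋊ Γ` with `Γ` dense in `SL(2, ℝ)` has small mass on `ℝ²` if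
finitely many inner translations move it little. -/
theorem exists_setLIntegral_ker_le (hΓ : Dense (Γ : Set SL(2, ℝ))) :
    ∃ r s t : PlaneSemidirect Γ, ∀ f : PlaneSemidirect Γ → ℂ, Integrable f Measure.haar →
      ∫⁻ x in ((SemidirectProduct.rightHom : PlaneSemidirect Γ →* Γ).ker : Set _),
        ‖f x‖ₑ ∂Measure.haar ≤
      3 * haarL1Norm (innerTranslate r f - f) + 2 * (haarL1Norm (innerTranslate s f - f) +
        haarL1Norm (innerTranslate t f - f)) := by
  obtain ⟨h, hh⟩ := exists_mem_entries_near hΓ ⟨!![0, 1; -1, 0], by simp [Matrix.det_fin_two]⟩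
    (show (0 : ℝ) < 1 / 100 by norm_num)
  obtain ⟨k, hk⟩ := exists_mem_entries_near hΓ
    ⟨!![0, 1 / 10; -10, 10 * 0], by simp [Matrix.det_fin_two]⟩ (show (0 : ℝ) < 1 / 100 by norm_num)
  obtain ⟨l, hl⟩ := exists_mem_entries_near hΓ
    ⟨!![0, 1 / 10; -10, 10 * (1 / 4)], by simp [Matrix.det_fin_two]⟩
    (show (0 : ℝ) < 1 / 100 by norm_num)
  let C : Γ → Set (Fin 2 → ℝ) := fun γ => {v | (γ : SL(2, ℝ)).1.mulVec v ∈ horizontalCone}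
  have hC : ∀ γ, MeasurableSet (planeSet Γ (C γ)) := fun γ => measurableSet_planeSet
    (measurableSet_horizontalCone.preimage (Continuous.matrix_mulVec continuous_const
      continuous_id).measurable)
  have hA := measurableSet_planeSet (Γ := Γ) measurableSet_horizontalCone
  -- Conjugation by `h` bounds the mass of `C h` by that of the cone, for the covering. The inverses
  -- of `k` and `l` bound the mass of the cone by those of `C k` and `C l`, for the disjointness.
  refine ⟨SemidirectProduct.inr h, SemidirectProduct.inr k⁻¹, SemidirectProduct.inr l⁻¹,
    fun f hf => ?_⟩
  have hr := setLIntegral_enorm_le_conj_add (SemidirectProduct.inr h) hf (hC h)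
  have hs := setLIntegral_enorm_le_conj_add (SemidirectProduct.inr k⁻¹) hf hA
  have ht := setLIntegral_enorm_le_conj_add (SemidirectProduct.inr l⁻¹) hf hA
  rw [conj_mem_planeSet] at hr hs ht
  have hCh : {v | ((h⁻¹ : Γ) : SL(2, ℝ)).1.mulVec v ∈ C h} = horizontalCone := by
    ext v
    have : (h : SL(2, ℝ)).1 * ((h⁻¹ : Γ) : SL(2, ℝ)).1 = 1 := by
      rw [← Matrix.SpecialLinearGroup.coe_mul, ← Subgroup.coe_mul, mul_inv_cancel]
      rfl
    simp only [C, Set.mem_ofPred_eq, Matrix.mulVec_mulVec, this, Matrix.one_mulVec]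
  rw [hCh] at hr
  rw [inv_inv] at hs ht
  set N : Set (PlaneSemidirect Γ) :=
    ((SemidirectProduct.rightHom : PlaneSemidirect Γ →* Γ).ker : Set (PlaneSemidirect Γ)) with hN
  have hcover : N ⊆ planeSet Γ horizontalCone ∪ planeSet Γ (C h) ∪ {1} := by
    intro p hp
    by_cases h0 : Multiplicative.toAdd p.left = 0
    · exact Or.inr (SemidirectProduct.ext h0 hp)
    · rcases mem_horizontalCone_or_mulVec_mem hh h0 with h1 | h1
      · exact Or.inl (Or.inl ⟨hp, h1⟩)
      · exact Or.inl (Or.inr ⟨hp, h1⟩)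
  have hd1 : Disjoint (planeSet Γ horizontalCone) (planeSet Γ (C k)) :=
    Set.disjoint_left.2 fun p hp hp' =>
      notMem_horizontalCone_of_mulVec_mem le_rfl (by norm_num) hk hp'.2 hp.2
  have hd2 : Disjoint (planeSet Γ horizontalCone ∪ planeSet Γ (C k)) (planeSet Γ (C l)) :=
    Set.disjoint_left.2 fun p hp hp' => hp.elim
      (fun hp => notMem_horizontalCone_of_mulVec_mem (by norm_num) le_rfl hl hp'.2 hp.2)
      (fun hp => mulVec_notMem_horizontalCone_of_mulVec_mem hk hl hp.2 hp'.2)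
  have hsub : planeSet Γ horizontalCone ∪ planeSet Γ (C k) ∪ planeSet Γ (C l) ⊆ N := by
    rintro p ((hp | hp) | hp) <;> exact hp.1
  have hup : ∫⁻ x in N, ‖f x‖ₑ ∂Measure.haar ≤
      ∫⁻ x in planeSet Γ horizontalCone, ‖f x‖ₑ ∂Measure.haar +
        ∫⁻ x in planeSet Γ (C h), ‖f x‖ₑ ∂Measure.haar := by
    refine (lintegral_mono_set hcover).trans ((lintegral_union_le _ _ _).trans ?_)
    rw [setLIntegral_measure_zero _ _ (measure_singleton _), add_zero]
    exact lintegral_union_le _ _ _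
  have hlow : ∫⁻ x in planeSet Γ horizontalCone, ‖f x‖ₑ ∂Measure.haar +
      ∫⁻ x in planeSet Γ (C k), ‖f x‖ₑ ∂Measure.haar +
      ∫⁻ x in planeSet Γ (C l), ‖f x‖ₑ ∂Measure.haar ≤ ∫⁻ x in N, ‖f x‖ₑ ∂Measure.haar := by
    rw [← lintegral_union (hC k) hd1, ← lintegral_union (hC l) hd2]
    exact lintegral_mono_set hsub
  have hfin : ∫⁻ x in N, ‖f x‖ₑ ∂Measure.haar ≠ ⊤ := hf.restrict.2.ne
  exact le_three_mul_add_two_mul hfin hup hlow hr hs ht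

end PlaneSemidirect

theorem mainTheorem5 (Γ : Subgroup SL(2, ℝ)) (hΓ : Dense (Γ : Set SL(2, ℝ))) :
    ¬ IsQSIN (PlaneSemidirect Γ) := by
  rintro ⟨ι, _, _, _, e, he, hinv⟩
  obtain ⟨r, s, t, hrst⟩ := PlaneSemidirect.exists_setLIntegral_ker_le hΓ
  set N := (SemidirectProduct.rightHom : PlaneSemidirect Γ →* Γ).ker with hN
  have hNo : IsOpen (N : Set (PlaneSemidirect Γ)) := PlaneSemidirect.isOpen_ker_rightHom Γ
  -- The indicator of a compact neighbourhood of `1` inside `N` is the test function: its positive,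
  -- finite Haar measure would be bounded by a quantity tending to `0`.
  obtain ⟨K, hKn, hKN, hKc⟩ := local_compact_nhds (hNo.mem_nhds N.one_mem)
  have hKm : MeasurableSet K := hKc.isClosed.measurableSet
  have hpos : 0 < (Measure.haar : Measure (PlaneSemidirect Γ)) K :=
    Measure.measure_pos_of_mem_nhds _ hKn
  have hfin : (Measure.haar : Measure (PlaneSemidirect Γ)) K ≠ ⊤ := hKc.measure_ne_top
  have hmass : Tendsto (fun i => ∫⁻ x in (N : Set (PlaneSemidirect Γ)), ‖e i x‖ₑ ∂Measure.haar)
      atTop (𝓝 0) := by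
    refine tendsto_of_tendsto_of_tendsto_of_le_of_le tendsto_const_nhds ?_
      (fun i => zero_le) (fun i => hrst (e i) (he.integrable i))
    have h := (ENNReal.Tendsto.const_mul (a := 3) (hinv r) (Or.inr (by simp))).add
      (ENNReal.Tendsto.const_mul (a := 2) ((hinv s).add (hinv t)) (Or.inr (by simp)))
    simpa using h
  have hint : Integrable (K.indicator (1 : PlaneSemidirect Γ → ℂ)) Measure.haar :=
    (integrable_indicator_iff hKm).2 (integrableOn_const hfin)
  have hlim := (ENNReal.Tendsto.mul_const hmass (Or.inr hfin)).add (he.left_approx _ hint)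
  rw [zero_mul, add_zero] at hlim
  exact hpos.not_ge (ge_of_tendsto' hlim fun i =>
    haar_le_mul_add_haarL1Norm (e i) N hNo.measurableSet hKm hKN)
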